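/- Let $A$ be a set of actions and $\mathcal V$ a set of variables. Consider the terms $$t ::= x \mid 0 \mid a.\textstyle\bigoplus_{i=1}^n [q_i]t_i \mid t_1+t_2 \mid t_1\parallel_B t_2 ,$$ where $x\in\mathcal V$, $a\in A$, $n\ge1$, $q_i\in(0,1]$, $\sum_i q_i=1$ and $B\subseteq A$. Processes are the closed terms. Their transitions $s\xrightarrow{a}\pi$, with $\pi$ a discrete probability distribution on processes, are those derivable by the following rules: * $a.\bigoplus_i[q_i]s_i\xrightarrow{a}\sum_i q_i\delta_{s_i}$; * $s_1+s_2\xrightarrow{a}\pi$ if $s_1\xrightarrow{a}\pi$ or $s_2\xrightarrow{a}\pi$; * $s_1\parallel_B s_2\xrightarrow{a}\pi_1\parallel_B\pi_2$ if $a\in B$, $s_1\xrightarrow{a}\pi_1$ and $s_2\xrightarrow{a}\pi_2$; * $s_1\parallel_B s_2\xrightarrow{a}\pi_1\parallel_B\delta_{s_2}$ if $a\notin B$ and $s_1\xrightarrow{a}\pi_1$; * $s_1\parallel_B s_2\xrightarrow{a}\delta_{s_1}\parallel_B\pi_2$ if $a\notin B$ and $s_2\xrightarrow{a}\pi_2$.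 Here $(\pi_1\parallel_B\pi_2)(s_1\parallel_B s_2)=\pi_1(s_1)\pi_2(s_2)$. Write $\Omega(p,p')$ for the set of couplings of two discrete distributions, and let $K(d)(\pi,\pi')=\inf_{\omega\in\Omega(\pi,\pi')}\sum_{s,s'}d(s,s')\,\omega(s,s')$. A bisimulation metric is a $[0,1]$-valued pseudometric $d$ on processes such that, whenever $d(s,s')<1$ and $s\xrightarrow{a}\pi$, there is $s'\xrightarrow{a}\pi'$ with $K(d)(\pi,\pi')\le d(s,s')$. Let $\mathbf d$ be the (pointwise) smallest bisimulation metric. A multiplicity is a map $m:\mathcal V\to\mathbb N\cup\{\infty\}$. A probabilistic multiplicity is a discrete probability distribution on multiplicities. Write $1_x$ for the multiplicity that is $1$ at $x$ and $0$ elsewhere. For probabilistic multiplicities, $p_1\sqsubseteq p_2$ means that some $\omega\in\Omega(p_1,p_2)$ satisfies $$\sum_{m'}\omega(m',m)\,m'(x)\ \le\ m(x)\sum_{m'}\omega(m',m)$$ for all $x\in\mathcal V$ and all $m$ with $\sum_{m'}\omega(m',m)>0$. Define $\llbracket t\rrbracket$, a set of probabilistic multiplicities, by recursion on $t$: * $\llbracket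 0\rrbracket=\{\delta_0\}$ and $\llbracket x\rrbracket=\{p\mid p\sqsubseteq\delta_{1_x}\}$; * $\llbracket t_1+t_2\rrbracket=\llbracket t_1\rrbracket\cup\llbracket t_2\rrbracket$; * $p\in\llbracket a.\bigoplus_i[q_i]t_i\rrbracket$ iff $p\sqsubseteq\sum_i q_ip_i$ for some $p_i\in\llbracket t_i\rrbracket$; * $p\in\llbracket t_1\parallel_B t_2\rrbracket$ iff there are $p_1\in\llbracket t_1\rrbracket$ and $p_2\in\llbracket t_2\rrbracket$ with $p\sqsubseteq p'$, where $p'(m)=\sum_{m_1+m_2=m}p_1(m_1)p_2(m_2)$. For $e:\mathcal V\to[0,1]$ put $$\mathrm{da}(P,e)=\sup_{p\in P}\ \sum_m p(m)\Bigl(1-\prod_{x\in\mathcal V}(1-e(x))^{m(x)}\Bigr),$$ with $a^\infty=\lim_n a^n$ for $a\in[0,1]$. **Theorem.** For every term $t$ and all closed substitutions $\sigma_1,\sigma_2$ (maps from $\mathcal V$ to processes), $$\mathbf d(\sigma_1(t),\sigma_2(t))\ \le\ \mathrm{da}\bigl(\llbracket t\rrbracket,\ x\mapsto\mathbf d(\sigma_1(x),\sigma_2(x))\bigr).$$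 -/

import Mathlib

open scoped ENNReal

universe u v

noncomputable section

namespace ProbPA

/-! ## Syntax and operational semantics -/

/-- Terms of the probabilistic process algebra over the actions `A` and the variables `V`:
variables, the stop process `0`, the probabilistic prefix `a.([q 1] t 1 ⊕ ⋯ ⊕ [q n] t n)`,
alternative composition, and the CSP-style parallel composition `∥_B` for `B ⊆ A`.
The prefix weights form a probability vector on `Fin n` with no zero entry, so
`q i ∈ (0,1]`, they sum up to `1`, and `n ≥ 1` follows. -/
inductive Term (A : Type u) (V : Type v) : Type (max u v)
  | var (x : V) : Term A V
  | nil : Term A V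
  | pre (a : A) (n : ℕ) (q : PMF (Fin n)) (hq : ∀ i, q i ≠ 0) (t : Fin n → Term A V) : Term A V
  | alt (t₁ t₂ : Term A V) : Term A V
  | par (B : Set A) (t₁ t₂ : Term A V) : Term A V

/-- Processes: closed terms. -/
abbrev Proc (A : Type u) : Type u := Term A Empty

/-- The closed instance `σ(t)` of the open term `t` under a closed substitution `σ`. -/
def Term.subst {A : Type u} {V : Type v} (σ : V → Proc A) : Term A V → Proc A
  | .var x => σ x
  | .nil => .nil
  | .pre a n q hq t => .pre a n q hq (fun i => (t i).subst σ)
  | .alt t₁ t₂ => .alt (t₁.subst σ) (t₂.subst σ)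
  | .par B t₁ t₂ => .par B (t₁.subst σ) (t₂.subst σ)

/-- The lifting `π₁ ∥_B π₂` of parallel composition to distributions:
`(π₁ ∥_B π₂)(s₁ ∥_B s₂) = π₁(s₁) · π₂(s₂)`. -/
def parDist {A : Type u} (B : Set A) (π₁ π₂ : PMF (Proc A)) : PMF (Proc A) :=
  π₁.bind fun s₁ => π₂.map fun s₂ => Term.par B s₁ s₂

/-- The probabilistic transition relation, one constructor per rule. -/
inductive Step {A : Type u} : Proc A → A → PMF (Proc A) → Prop
  | pre (a : A) (n : ℕ) (q : PMF (Fin n)) (hq : ∀ i, q i ≠ 0) (t : Fin n → Proc A) :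
      Step (.pre a n q hq t) a (q.bind fun i => PMF.pure (t i))
  | alt_left {a : A} {s₁ s₂ : Proc A} {π : PMF (Proc A)} :
      Step s₁ a π → Step (.alt s₁ s₂) a π
  | alt_right {a : A} {s₁ s₂ : Proc A} {π : PMF (Proc A)} :
      Step s₂ a π → Step (.alt s₁ s₂) a π
  | par_sync {a : A} {B : Set A} {s₁ s₂ : Proc A} {π₁ π₂ : PMF (Proc A)} :
      a ∈ B → Step s₁ a π₁ → Step s₂ a π₂ → Step (.par B s₁ s₂) a (parDist B π₁ π₂)
  | par_left {a : A} {B : Set A} {s₁ s₂ : Proc A} {π₁ : PMF (Proc A)} :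
      a ∉ B → Step s₁ a π₁ → Step (.par B s₁ s₂) a (parDist B π₁ (PMF.pure s₂))
  | par_right {a : A} {B : Set A} {s₁ s₂ : Proc A} {π₂ : PMF (Proc A)} :
      a ∉ B → Step s₂ a π₂ → Step (.par B s₁ s₂) a (parDist B (PMF.pure s₁) π₂)

/-! ## The bisimilarity metric

All distances are valued in `ℝ≥0∞` and bounded by `1`. -/

/-- The set `Ω(π, π')` of matchings (couplings) of two discrete distributions. -/
def Matching {α : Type*} {β : Type*} (π : PMF α) (π' : PMF β) : Set (PMF (α × β)) :=
  {ω | (∀ s, ∑' t, ω (s, t) = π s) ∧ ∀ t, ∑' s, ω (s, t) = π' t}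

/-- The Kantorovich lifting of a distance on processes to distributions. -/
def kantorovich {A : Type u} (d : Proc A → Proc A → ℝ≥0∞) (π π' : PMF (Proc A)) : ℝ≥0∞ :=
  ⨅ ω ∈ Matching π π', ∑' s, ∑' t, d s t * ω (s, t)

/-- A `1`-bounded pseudometric `d` is a bisimulation metric if, whenever `d s t < 1`, every
transition of `s` is mimicked by `t` with Kantorovich distance at most `d s t`. -/
structure IsBisimulationMetric {A : Type u} (d : Proc A → Proc A → ℝ≥0∞) : Prop where
  le_one : ∀ s t, d s t ≤ 1
  self : ∀ s, d s s = 0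
  symm : ∀ s t, d s t = d t s
  triangle : ∀ s t r, d s r ≤ d s t + d t r
  transfer : ∀ s t, d s t < 1 → ∀ a π, Step s a π →
    ∃ π', Step t a π' ∧ kantorovich d π π' ≤ d s t

/-- The bisimilarity metric: the pointwise infimum of all bisimulation metrics. It is itself
a bisimulation metric, hence the smallest one, see `bisimilarityMetric_isLeast` below. -/
def bisimilarityMetric (A : Type u) (s t : Proc A) : ℝ≥0∞ :=
  ⨅ d ∈ {d : Proc A → Proc A → ℝ≥0∞ | IsBisimulationMetric d}, d s t

section WellDefined

variable {A : Type u}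

theorem step_finite (s : Proc A) (a : A) : {π | Step s a π}.Finite := by
  induction s with
  | var x => exact x.elim
  | nil => exact Set.Finite.subset Set.finite_empty (by intro π h; cases h)
  | pre b n q hq t _ =>
    refine (Set.finite_singleton (q.bind fun i => PMF.pure (t i))).subset ?_
    intro π h; cases h; rfl
  | alt s₁ s₂ h₁ h₂ =>
    refine (h₁.union h₂).subset ?_
    intro π h
    cases h with
    | alt_left h => exact Or.inl h
    | alt_right h => exact Or.inr h
  | par B s₁ s₂ h₁ h₂ =>
    refine (((Set.Finite.image2 (parDist B) h₁ h₂).union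
      (h₁.image fun π => parDist B π (PMF.pure s₂))).union
      (h₂.image fun π => parDist B (PMF.pure s₁) π)).subset ?_
    intro π h
    cases h with
    | par_sync _ h h' => exact Or.inl (Or.inl ⟨_, h, _, h', rfl⟩)
    | par_left _ h => exact Or.inl (Or.inr ⟨_, h, rfl⟩)
    | par_right _ h => exact Or.inr ⟨_, h, rfl⟩

theorem kantorovich_mono {d e : Proc A → Proc A → ℝ≥0∞} (h : ∀ s t, d s t ≤ e s t)
    (π π' : PMF (Proc A)) : kantorovich d π π' ≤ kantorovich e π π' := by
  unfold kantorovich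
  gcongr
  exact h _ _

theorem kantorovich_self {d : Proc A → Proc A → ℝ≥0∞} (h : ∀ s, d s s = 0)
    (π : PMF (Proc A)) : kantorovich d π π = 0 := by
  classical
  have key : ∀ s t, (π.map fun r => (r, r)) (s, t) = if s = t then π s else 0 := by
    intro s t
    rw [PMF.map_apply]
    by_cases hst : s = t
    · subst hst
      rw [tsum_eq_single s]
      · simp
      · intro r hr
        simp [hr.symm]
    · rw [if_neg hst, ENNReal.tsum_eq_zero]
      intro r
      rw [if_neg]
      rintro ⟨⟩
      exact hst rfl
  refine le_antisymm ?_ zero_le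
  have hmem : (π.map fun r => (r, r)) ∈ Matching π π := by
    refine ⟨fun s => ?_, fun t => ?_⟩
    · simp only [key]
      rw [tsum_eq_single s (fun t ht => if_neg ht.symm), if_pos rfl]
    · simp only [key]
      rw [tsum_eq_single t (fun s hs => if_neg hs), if_pos rfl]
  refine (iInf₂_le _ hmem).trans ?_
  simp only [key]
  refine le_of_eq (ENNReal.tsum_eq_zero.2 fun s => ENNReal.tsum_eq_zero.2 fun t => ?_)
  by_cases hst : s = t
  · subst hst; simp [h]
  · simp [hst]

/-- The gluing of two matchings along their common marginal. -/
theorem exists_glue {π π' π'' : PMF (Proc A)} {ω₁ ω₂ : PMF (Proc A × Proc A)}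
    (h₁ : ω₁ ∈ Matching π π') (h₂ : ω₂ ∈ Matching π' π'') :
    ∃ ω ∈ Matching π π'', ∀ s r,
      ω (s, r) = ∑' t, ω₁ (s, t) * ((π' t)⁻¹ * ω₂ (t, r)) := by
  have z₁ : ∀ s t, π' t = 0 → ω₁ (s, t) = 0 := fun s t ht =>
    ENNReal.tsum_eq_zero.1 ((h₁.2 t).trans ht) s
  have z₂ : ∀ t r, π' t = 0 → ω₂ (t, r) = 0 := fun t r ht =>
    ENNReal.tsum_eq_zero.1 ((h₂.1 t).trans ht) r
  have m₁ : ∀ s, ∑' r, ∑' t, ω₁ (s, t) * ((π' t)⁻¹ * ω₂ (t, r)) = π s := by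
    intro s
    rw [ENNReal.tsum_comm, ← h₁.1 s]
    refine tsum_congr fun t => ?_
    rw [ENNReal.tsum_mul_left, ENNReal.tsum_mul_left, h₂.1 t]
    by_cases ht : π' t = 0
    · simp [z₁ s t ht]
    · rw [ENNReal.inv_mul_cancel ht (π'.apply_ne_top t), mul_one]
  have m₂ : ∀ r, ∑' s, ∑' t, ω₁ (s, t) * ((π' t)⁻¹ * ω₂ (t, r)) = π'' r := by
    intro r
    rw [ENNReal.tsum_comm, ← h₂.2 r]
    refine tsum_congr fun t => ?_
    rw [ENNReal.tsum_mul_right, h₁.2 t, ← mul_assoc]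
    by_cases ht : π' t = 0
    · simp [z₂ t r ht]
    · rw [ENNReal.mul_inv_cancel ht (π'.apply_ne_top t), one_mul]
  let f : Proc A × Proc A → ℝ≥0∞ := fun p => ∑' t, ω₁ (p.1, t) * ((π' t)⁻¹ * ω₂ (t, p.2))
  have hf : ∑' p, f p = 1 := by
    rw [ENNReal.tsum_prod', ← π.tsum_coe]
    exact tsum_congr m₁
  exact ⟨⟨f, hf ▸ ENNReal.summable.hasSum⟩, ⟨m₁, m₂⟩, fun s r => rfl⟩

theorem kantorovich_triangle {l e : Proc A → Proc A → ℝ≥0∞}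
    (h : ∀ s t r, e s r ≤ l s t + l t r) (π π' π'' : PMF (Proc A)) :
    kantorovich e π π'' ≤ kantorovich l π π' + kantorovich l π' π'' := by
  refine ENNReal.le_iInf₂_add_iInf₂ fun ω₁ h₁ ω₂ h₂ => ?_
  obtain ⟨ω, hω, hval⟩ := exists_glue h₁ h₂
  refine (iInf₂_le ω hω).trans ?_
  let g : Proc A → Proc A → Proc A → ℝ≥0∞ := fun s t r => ω₁ (s, t) * ((π' t)⁻¹ * ω₂ (t, r))
  have hinv : ∀ t, (π' t)⁻¹ * π' t ≤ 1 := fun t => ENNReal.inv_mul_le_one _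
  calc ∑' s, ∑' r, e s r * ω (s, r)
      ≤ ∑' s, ∑' r, ∑' t, (l s t * g s t r + l t r * g s t r) := by
        refine ENNReal.tsum_le_tsum fun s => ENNReal.tsum_le_tsum fun r => ?_
        rw [hval, ← ENNReal.tsum_mul_left]
        refine ENNReal.tsum_le_tsum fun t => ?_
        rw [← add_mul]
        exact mul_le_mul_left (h s t r) _
    _ = (∑' s, ∑' r, ∑' t, l s t * g s t r) + ∑' s, ∑' r, ∑' t, l t r * g s t r := by
        simp only [ENNReal.tsum_add]
    _ ≤ (∑' s, ∑' t, l s t * ω₁ (s, t)) + ∑' t, ∑' r, l t r * ω₂ (t, r) := by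
        refine add_le_add ?_ ?_
        · refine ENNReal.tsum_le_tsum fun s => ?_
          rw [ENNReal.tsum_comm]
          refine ENNReal.tsum_le_tsum fun t => ?_
          simp only [g]
          rw [ENNReal.tsum_mul_left, ENNReal.tsum_mul_left, ENNReal.tsum_mul_left, h₂.1 t]
          calc l s t * (ω₁ (s, t) * ((π' t)⁻¹ * π' t)) ≤ l s t * (ω₁ (s, t) * 1) := by
                gcongr; exact hinv t
            _ = l s t * ω₁ (s, t) := by rw [mul_one]
        · have : ∀ s, ∑' r, ∑' t, l t r * g s t r = ∑' t, ∑' r, l t r * g s t r :=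
            fun s => ENNReal.tsum_comm
          simp only [this]
          rw [ENNReal.tsum_comm]
          refine ENNReal.tsum_le_tsum fun t => ?_
          rw [ENNReal.tsum_comm]
          refine ENNReal.tsum_le_tsum fun r => ?_
          simp only [g]
          rw [ENNReal.tsum_mul_left, ENNReal.tsum_mul_right, h₁.2 t]
          calc l t r * (π' t * ((π' t)⁻¹ * ω₂ (t, r)))
              = l t r * (((π' t)⁻¹ * π' t) * ω₂ (t, r)) := by ring
            _ ≤ l t r * (1 * ω₂ (t, r)) := by gcongr; exact hinv t
            _ = l t r * ω₂ (t, r) := by rw [one_mul]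

/-- The transfer condition of a bisimulation metric. -/
def Transfer (d : Proc A → Proc A → ℝ≥0∞) : Prop :=
  ∀ s t, d s t < 1 → ∀ a π, Step s a π → ∃ π', Step t a π' ∧ kantorovich d π π' ≤ d s t

/-- A pointwise infimum of distances satisfies the transfer condition if each transition can be
mimicked with respect to each of the distances below `1`. -/
theorem transfer_of_iInf {ι : Type*} (l d : Proc A → Proc A → ℝ≥0∞)
    (c : Proc A → Proc A → ι → ℝ≥0∞) (hd : ∀ s t, d s t = ⨅ i, c s t i)
    (h : ∀ s t i, c s t i < 1 → ∀ a π, Step s a π →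
      ∃ π', Step t a π' ∧ kantorovich l π π' ≤ c s t i) :
    ∀ s t, d s t < 1 → ∀ a π, Step s a π → ∃ π', Step t a π' ∧ kantorovich l π π' ≤ d s t := by
  intro s t hst a π hπ
  rw [hd] at hst ⊢
  obtain ⟨i₀, hi₀⟩ := iInf_lt_iff.1 hst
  obtain ⟨π₀, hπ₀, -⟩ := h s t i₀ hi₀ a π hπ
  obtain ⟨π', hπ', hmin⟩ :=
    Set.exists_min_image _ (fun π' => kantorovich l π π') (step_finite t a) ⟨π₀, hπ₀⟩
  refine ⟨π', hπ', le_iInf fun i => ?_⟩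
  have key : ∀ j, c s t j < 1 → kantorovich l π π' ≤ c s t j := by
    intro j hj
    obtain ⟨π₁, hπ₁, hle⟩ := h s t j hj a π hπ
    exact (hmin π₁ hπ₁).trans hle
  rcases lt_or_ge (c s t i) 1 with hi | hi
  · exact key i hi
  · exact (key i₀ hi₀).trans (hi₀.le.trans hi)

theorem bisimilarityMetric_isLeast (A : Type u) :
    IsLeast {d : Proc A → Proc A → ℝ≥0∞ | IsBisimulationMetric d} (bisimilarityMetric A) := by
  classical
  let L : Set (Proc A → Proc A → ℝ≥0∞) := {d | Transfer d ∧ Transfer fun s t => d t s}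
  let l : Proc A → Proc A → ℝ≥0∞ := fun s t => ⨅ d : L, d.1 s t
  have hle : ∀ d ∈ L, ∀ s t, l s t ≤ d s t := fun d hd s t => iInf_le (fun d : L => d.1 s t) ⟨d, hd⟩
  have hsymm : ∀ s t, l s t = l t s := by
    have : ∀ s t, l s t ≤ l t s := fun s t =>
      le_iInf fun d => hle (fun s t => d.1 t s) ⟨d.2.2, d.2.1⟩ s t
    exact fun s t => le_antisymm (this s t) (this t s)
  have htr : Transfer l := by
    refine transfer_of_iInf l l (fun s t (d : L) => d.1 s t) (fun _ _ => rfl) ?_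
    intro s t d hd a π hπ
    obtain ⟨π', hπ', hk⟩ := d.2.1 s t hd a π hπ
    exact ⟨π', hπ', (kantorovich_mono (hle d.1 d.2) π π').trans hk⟩
  have hdisc : ∀ s t, l s t ≤ if s = t then 0 else 1 := by
    have hT : Transfer fun s t : Proc A => if s = t then (0 : ℝ≥0∞) else 1 := by
      intro s t hst a π hπ
      by_cases h : s = t
      · subst h
        exact ⟨π, hπ, by rw [kantorovich_self (fun s => if_pos rfl)]; exact zero_le⟩
      · simp [h] at hst
    refine hle _ ⟨hT, ?_⟩
    convert hT using 4
    exact eq_comm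
  have htri : ∀ s t r, l s r ≤ l s t + l t r := by
    let e : Proc A → Proc A → ℝ≥0∞ := fun s r => ⨅ t, (l s t + l t r)
    have hsw : (fun s r => e r s) = e := by
      funext s r
      refine iInf_congr fun t => ?_
      rw [hsymm r t, hsymm t s, add_comm]
    have he : Transfer e := by
      refine transfer_of_iInf e e (fun s r t => l s t + l t r) (fun _ _ => rfl) ?_
      intro s r t hlt a π hπ
      obtain ⟨π', hπ', hk⟩ := htr s t (lt_of_le_of_lt le_self_add hlt) a π hπ
      obtain ⟨π'', hπ'', hk'⟩ := htr t r (lt_of_le_of_lt le_add_self hlt) a π' hπ'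
      exact ⟨π'', hπ'', (kantorovich_triangle (fun s t r => iInf_le _ t) π π' π'').trans
        (add_le_add hk hk')⟩
    have heL : e ∈ L := ⟨he, by rw [hsw]; exact he⟩
    exact fun s t r => (hle e heL s r).trans (iInf_le _ t)
  have hl : IsBisimulationMetric l :=
    { le_one := fun s t => (hdisc s t).trans (by split_ifs <;> simp)
      self := fun s => le_antisymm ((hdisc s s).trans (by simp)) zero_le
      symm := hsymm
      triangle := htri
      transfer := htr }
  have heq : bisimilarityMetric A = l := by
    funext s t
    refine le_antisymm (iInf₂_le l hl) (le_iInf₂ fun d hd => hle d ⟨hd.transfer, ?_⟩ s t)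
    have : (fun s t => d t s) = d := by
      funext s t
      exact hd.symm t s
    rw [this]
    exact hd.transfer
  exact ⟨heq ▸ hl, fun d hd s t => iInf₂_le d hd⟩

end WellDefined

/-! ## Denotations and distance approximation -/

/-- Multiplicities `V → ℕ ∪ {∞}`. -/
abbrev Mult (V : Type v) : Type v := V → ℕ∞

/-- Probabilistic multiplicities: discrete probability distributions over multiplicities. -/
abbrev ProbMult (V : Type v) : Type v := PMF (Mult V)

/-- The multiplicity `1_x`. -/
def Mult.one {V : Type v} (x : V) : Mult V :=
  open Classical in fun y => if y = x then 1 else 0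

/-- The weighting of a subdistribution `ρ` over multiplicities: the mean number of copies of
each variable after normalising `ρ`, and `0` if `ρ` has size `0`. -/
def weighting {V : Type v} (ρ : Mult V → ℝ≥0∞) (x : V) : ℝ≥0∞ :=
  open Classical in
  if ∑' m, ρ m = 0 then 0 else (∑' m, ρ m)⁻¹ * ∑' m, ρ m * ((m x : ℕ∞) : ℝ≥0∞)

/-- The order `p₁ ⊑ p₂` on probabilistic multiplicities. -/
def ProbMult.Below {V : Type v} (p₁ p₂ : ProbMult V) : Prop :=
  ∃ ω ∈ Matching p₁ p₂, ∀ (m : Mult V) (x : V),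
    weighting (fun m₁ => ω (m₁, m)) x ≤ ((m x : ℕ∞) : ℝ≥0∞)

/-- The downward closure of a set of probabilistic multiplicities. -/
def downset {V : Type v} (P : Set (ProbMult V)) : Set (ProbMult V) :=
  {p | ∃ p' ∈ P, p.Below p'}

/-- The distribution of `m₁ + m₂` for independent `m₁ ∼ p₁` and `m₂ ∼ p₂`, that is
`m ↦ ∑_{m₁ + m₂ = m} p₁(m₁) · p₂(m₂)`. -/
def convolution {V : Type v} (p₁ p₂ : ProbMult V) : ProbMult V :=
  p₁.bind fun m₁ => p₂.map fun m₂ => m₁ + m₂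

/-- The denotation `⟦t⟧` of an open term. -/
def Term.denotation {A : Type u} {V : Type v} : Term A V → Set (ProbMult V)
  | .var x => downset {PMF.pure (Mult.one x)}
  | .nil => {PMF.pure 0}
  | .pre _ n q _ t =>
      {p | ∃ p' : Fin n → ProbMult V, (∀ i, p' i ∈ (t i).denotation) ∧ p.Below (q.bind p')}
  | .alt t₁ t₂ => t₁.denotation ∪ t₂.denotation
  | .par _ t₁ t₂ =>
      {p | ∃ p₁ ∈ t₁.denotation, ∃ p₂ ∈ t₂.denotation, p.Below (convolution p₁ p₂)}

/-- The power `a ^ k` for `a ∈ [0,1]` and `k ∈ ℕ ∪ {∞}`; here `a ^ ∞ = lim a ^ n = inf a ^ n`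
is `1` for `a = 1` and `0` for `a < 1`. -/
def enatPow (a : ℝ≥0∞) : ℕ∞ → ℝ≥0∞
  | (n : ℕ) => a ^ n
  | ⊤ => ⨅ n : ℕ, a ^ n

/-- The deterministic distance approximation `1 - ∏ x, (1 - e x) ^ m x` for a process distance
`e` with values in `[0,1]`. The (possibly infinite) product always converges, see
`multipliable_dda`. -/
def dda {V : Type v} (m : Mult V) (e : V → ℝ≥0∞) : ℝ≥0∞ :=
  1 - ∏' x, enatPow (1 - e x) (m x)

theorem multipliable_dda {V : Type v} (m : Mult V) (e : V → ℝ≥0∞) :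
    Multipliable fun x => enatPow (1 - e x) (m x) := by
  classical
  have h1 : ∀ x, enatPow (1 - e x) (m x) ≤ 1 := by
    intro x
    cases m x with
    | top => exact (iInf_le _ 0).trans (by simp)
    | coe n => exact pow_le_one₀ zero_le tsub_le_self
  refine ⟨_, tendsto_atTop_iInf ?_⟩
  intro s t hst
  exact Finset.prod_le_prod_of_subset_of_le_one' hst fun i _ _ => h1 i

/-- The probabilistic distance approximation: the expectation of `dda`. -/
def pda {V : Type v} (p : ProbMult V) (e : V → ℝ≥0∞) : ℝ≥0∞ :=
  ∑' m, p m * dda m e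

/-- The nondeterministic probabilistic distance approximation: the supremum of `pda`. -/
def da {V : Type v} (P : Set (ProbMult V)) (e : V → ℝ≥0∞) : ℝ≥0∞ :=
  ⨆ p ∈ P, pda p e

end ProbPA

end

/-!
The bound holds because each operator of the process algebra is at most as expansive for the
bisimilarity metric `𝐝` as its denotation says, so that the theorem follows by structural induction.

The metric lies below every symmetric distance that satisfies the transfer condition
(`bisimilarityMetric_le_of_transfer`), which gives a local principle: `𝐝 s t ≤ v` as soon as `v ≥ 1`
or `s` and `t` mimic each other's transitions at Kantorovich distance at most `v`
(`bisimilarityMetric_le_of_mimic`). From these principles one obtains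
* `𝐝 (a.⊕ᵢ [qᵢ]sᵢ) (a.⊕ᵢ [qᵢ]tᵢ) ≤ ∑ᵢ qᵢ 𝐝 sᵢ tᵢ`, by coupling the two sides along `i`;
* `𝐝 (s₁ + s₂) (t₁ + t₂) ≤ max (𝐝 s₁ t₁) (𝐝 s₂ t₂)`;
* `𝐝 (s₁ ∥ s₂) (t₁ ∥ t₂) ≤ 1 - (1 - 𝐝 s₁ t₁)(1 - 𝐝 s₂ t₂)`, by running couplings of the two
  components independently: the expectation of `1 - (1 - f)(1 - g)` for independent `f` and `g` is
  the same expression in the expectations of `f` and `g` (`tsum_mul_tsum_mul_probOr`).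

The expected approximation `pda` satisfies the corresponding equalities for mixtures of
distributions (`pda_bind`) and for convolutions (`pda_convolution`). Since `⊑` is reflexive, the
mixtures and convolutions of elements of the denotations of the subterms are in the denotation of
the whole term, and both equalities pass to the suprema `da` as inequalities (`tsum_mul_da_le`,
`probOr_da_le`).
-/

open scoped ENNReal

namespace ProbPA

/-! ### Expectations under discrete distributions -/

section Expectation

variable {α β : Type*}

theorem tsum_bind_mul (p : PMF α) (k : α → PMF β) (f : β → ℝ≥0∞) :
    ∑' b, p.bind k b * f b = ∑' a, p a * ∑' b, k a b * f b := by
  simp only [PMF.bind_apply, ← ENNReal.tsum_mul_right, ← ENNReal.tsum_mul_left]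
  rw [ENNReal.tsum_comm]
  simp only [mul_assoc]

theorem tsum_pure_mul (a : α) (f : α → ℝ≥0∞) : ∑' b, PMF.pure a b * f b = f a := by
  rw [tsum_eq_single a]
  · simp
  · intro b hb
    simp [hb]

theorem tsum_map_mul (p : PMF α) (g : α → β) (f : β → ℝ≥0∞) :
    ∑' b, p.map g b * f b = ∑' a, p a * f (g a) := by
  rw [PMF.map, tsum_bind_mul]
  simp only [Function.comp_apply, tsum_pure_mul]

theorem tsum_mul_le_one (p : PMF α) {f : α → ℝ≥0∞} (hf : ∀ a, f a ≤ 1) :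
    ∑' a, p a * f a ≤ 1 := by
  rw [← p.tsum_coe]
  exact ENNReal.tsum_le_tsum fun a => mul_le_of_le_one_right' (hf a)

theorem tsum_mul_one_sub (p : PMF α) {f : α → ℝ≥0∞} (hf : ∀ a, f a ≤ 1) :
    ∑' a, p a * (1 - f a) = 1 - ∑' a, p a * f a := by
  refine ENNReal.eq_sub_of_add_eq
    (ne_top_of_le_ne_top ENNReal.one_ne_top (tsum_mul_le_one p hf)) ?_
  rw [← ENNReal.tsum_add]
  refine (tsum_congr fun a => ?_).trans p.tsum_coe
  rw [← mul_add, tsub_add_cancel_of_le (hf a), mul_one]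

/-- The probability `1 - (1 - u)(1 - v)` that at least one of two independent events of
probabilities `u` and `v` occurs. -/
noncomputable def probOr (u v : ℝ≥0∞) : ℝ≥0∞ := 1 - (1 - u) * (1 - v)

theorem probOr_comm (u v : ℝ≥0∞) : probOr u v = probOr v u := by
  rw [probOr, probOr, mul_comm]

theorem probOr_mono {u u' v v' : ℝ≥0∞} (hu : u ≤ u') (hv : v ≤ v') :
    probOr u v ≤ probOr u' v' := by
  unfold probOr
  gcongr

theorem le_probOr_left (u v : ℝ≥0∞) (hu : u ≤ 1) : u ≤ probOr u v := by
  calc u = 1 - (1 - u) := (ENNReal.sub_sub_cancel ENNReal.one_ne_top hu).symm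
    _ ≤ probOr u v := tsub_le_tsub_left (mul_le_of_le_one_right' tsub_le_self) 1

theorem le_probOr_right (u v : ℝ≥0∞) (hv : v ≤ 1) : v ≤ probOr u v :=
  probOr_comm v u ▸ le_probOr_left v u hv

theorem probOr_add_left_le (u v ε : ℝ≥0∞) : probOr (u + ε) v ≤ probOr u v + ε := by
  unfold probOr
  rw [tsub_le_iff_right]
  have h : (1 - u) * (1 - v) ≤ (1 - (u + ε)) * (1 - v) + ε := by
    calc (1 - u) * (1 - v) ≤ ((1 - (u + ε)) + ε) * (1 - v) := by
          gcongr
          rw [← tsub_tsub]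
          exact le_tsub_add
      _ = (1 - (u + ε)) * (1 - v) + ε * (1 - v) := add_mul _ _ _
      _ ≤ _ := by
          gcongr
          exact mul_le_of_le_one_right' tsub_le_self
  calc (1 : ℝ≥0∞) ≤ 1 - (1 - u) * (1 - v) + (1 - u) * (1 - v) := le_tsub_add
    _ ≤ 1 - (1 - u) * (1 - v) + ((1 - (u + ε)) * (1 - v) + ε) := by gcongr
    _ = _ := by ring

theorem probOr_add_le (u v ε : ℝ≥0∞) : probOr (u + ε) (v + ε) ≤ probOr u v + (ε + ε) :=
  calc probOr (u + ε) (v + ε) ≤ probOr u (v + ε) + ε := probOr_add_left_le _ _ _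
    _ = probOr (v + ε) u + ε := by rw [probOr_comm]
    _ ≤ probOr v u + ε + ε := by
        gcongr
        exact probOr_add_left_le _ _ _
    _ = _ := by rw [probOr_comm, add_assoc]

/-- The expectation of `probOr` for two independent `[0,1]`-valued random variables. -/
theorem tsum_mul_tsum_mul_probOr (p : PMF α) (q : PMF β) {f : α → ℝ≥0∞} {g : β → ℝ≥0∞}
    (hf : ∀ a, f a ≤ 1) (hg : ∀ b, g b ≤ 1) :
    ∑' a, p a * ∑' b, q b * probOr (f a) (g b) =
      probOr (∑' a, p a * f a) (∑' b, q b * g b) := by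
  have inner : ∀ u : ℝ≥0∞, ∑' b, q b * probOr u (g b) = probOr u (∑' b, q b * g b) := by
    intro u
    unfold probOr
    rw [tsum_mul_one_sub q fun b => mul_le_one' tsub_le_self tsub_le_self,
      ← tsum_mul_one_sub q hg, ← ENNReal.tsum_mul_left]
    congr 2 with b
    ring
  simp only [inner]
  unfold probOr
  rw [tsum_mul_one_sub p fun a => mul_le_one' tsub_le_self tsub_le_self,
    ← tsum_mul_one_sub p hf, ← ENNReal.tsum_mul_right]
  congr 2 with a
  ring

end Expectation

/-! ### Couplings and the Kantorovich lifting -/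

theorem mem_matching_of_map {α β : Type*} {π : PMF α} {π' : PMF β} {ω : PMF (α × β)}
    (h₁ : ω.map Prod.fst = π) (h₂ : ω.map Prod.snd = π') : ω ∈ Matching π π' := by
  classical
  refine ⟨fun s => ?_, fun t => ?_⟩
  · rw [← h₁, PMF.map_apply, ENNReal.tsum_prod', tsum_eq_single s]
    · simp
    · intro s' hs
      simp [hs.symm]
  · rw [← h₂, PMF.map_apply, ENNReal.tsum_prod', ENNReal.tsum_comm, tsum_eq_single t]
    · simp
    · intro t' ht
      simp [ht.symm]

theorem map_fst_of_mem_matching {α β : Type*} {π : PMF α} {π' : PMF β} {ω : PMF (α × β)}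
    (h : ω ∈ Matching π π') : ω.map Prod.fst = π := by
  ext s
  rw [← h.1, (mem_matching_of_map (π := ω.map Prod.fst) rfl rfl).1]

theorem map_snd_of_mem_matching {α β : Type*} {π : PMF α} {π' : PMF β} {ω : PMF (α × β)}
    (h : ω ∈ Matching π π') : ω.map Prod.snd = π' := by
  ext s
  rw [← h.2, (mem_matching_of_map (π' := ω.map Prod.snd) rfl rfl).2]

section Kantorovich

variable {A : Type u}

theorem kantorovich_le {d : Proc A → Proc A → ℝ≥0∞} {π π' : PMF (Proc A)}
    {ω : PMF (Proc A × Proc A)} (h : ω ∈ Matching π π') :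
    kantorovich d π π' ≤ ∑' r, ω r * d r.1 r.2 := by
  refine (iInf₂_le ω h).trans_eq ?_
  rw [ENNReal.tsum_prod']
  simp only [mul_comm]

theorem exists_matching_lt {d : Proc A → Proc A → ℝ≥0∞} {π π' : PMF (Proc A)} {c : ℝ≥0∞}
    (h : kantorovich d π π' < c) : ∃ ω ∈ Matching π π', ∑' r, ω r * d r.1 r.2 < c := by
  simp only [kantorovich, iInf_lt_iff] at h
  obtain ⟨ω, hω, hlt⟩ := h
  refine ⟨ω, hω, ?_⟩
  rw [ENNReal.tsum_prod']
  simpa only [mul_comm] using hlt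

theorem kantorovich_map_le {ι : Type*} (d : Proc A → Proc A → ℝ≥0∞) (q : PMF ι)
    (s t : ι → Proc A) : kantorovich d (q.map s) (q.map t) ≤ ∑' i, q i * d (s i) (t i) := by
  have h : (q.map fun i => (s i, t i)) ∈ Matching (q.map s) (q.map t) :=
    mem_matching_of_map (by rw [PMF.map_comp]; rfl) (by rw [PMF.map_comp]; rfl)
  exact (kantorovich_le h).trans_eq (tsum_map_mul _ _ _)

theorem kantorovich_pure_le (d : Proc A → Proc A → ℝ≥0∞) (s t : Proc A) :
    kantorovich d (PMF.pure s) (PMF.pure t) ≤ d s t := by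
  have h := kantorovich_map_le d (PMF.pure ()) (fun _ => s) (fun _ => t)
  rwa [PMF.pure_map, PMF.pure_map, tsum_pure_mul] at h

/-- The parallel composition of two couplings: the two are run independently of each other. -/
noncomputable def parMatching (B : Set A) (ω₁ ω₂ : PMF (Proc A × Proc A)) :
    PMF (Proc A × Proc A) :=
  ω₁.bind fun r₁ => ω₂.map fun r₂ => (Term.par B r₁.1 r₂.1, Term.par B r₁.2 r₂.2)

theorem parMatching_mem {B : Set A} {π₁ π₁' π₂ π₂' : PMF (Proc A)}
    {ω₁ ω₂ : PMF (Proc A × Proc A)} (h₁ : ω₁ ∈ Matching π₁ π₁') (h₂ : ω₂ ∈ Matching π₂ π₂') :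
    parMatching B ω₁ ω₂ ∈ Matching (parDist B π₁ π₂) (parDist B π₁' π₂') := by
  refine mem_matching_of_map ?_ ?_
  · rw [← map_fst_of_mem_matching h₁, ← map_fst_of_mem_matching h₂]
    simp only [parMatching, parDist, PMF.map_bind, PMF.bind_map, PMF.map_comp]
    rfl
  · rw [← map_snd_of_mem_matching h₁, ← map_snd_of_mem_matching h₂]
    simp only [parMatching, parDist, PMF.map_bind, PMF.bind_map, PMF.map_comp]
    rfl

/-- The bounds `u` and `v` below `1` matter only in that they are finite: near-optimal couplings of
the two components then exist, and their independent parallel composition witnesses the claim. -/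
theorem kantorovich_parDist_le {B : Set A} {c d : Proc A → Proc A → ℝ≥0∞}
    (hd : ∀ s t, d s t ≤ 1)
    (hc : ∀ s₁ s₂ t₁ t₂, c (.par B s₁ s₂) (.par B t₁ t₂) ≤ probOr (d s₁ t₁) (d s₂ t₂))
    {π₁ π₁' π₂ π₂' : PMF (Proc A)} {u v : ℝ≥0∞} (hu : u < 1) (hv : v < 1)
    (h₁ : kantorovich d π₁ π₁' ≤ u) (h₂ : kantorovich d π₂ π₂' ≤ v) :
    kantorovich c (parDist B π₁ π₂) (parDist B π₁' π₂') ≤ probOr u v := by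
  refine ENNReal.le_of_forall_pos_le_add fun ε hε _ => ?_
  have hε' : (ε / 2 : ℝ≥0∞) ≠ 0 := by simpa using hε.ne'
  obtain ⟨ω₁, hω₁, hlt₁⟩ := exists_matching_lt
    (h₁.trans_lt (ENNReal.lt_add_right (hu.trans ENNReal.one_lt_top).ne hε'))
  obtain ⟨ω₂, hω₂, hlt₂⟩ := exists_matching_lt
    (h₂.trans_lt (ENNReal.lt_add_right (hv.trans ENNReal.one_lt_top).ne hε'))
  calc kantorovich c (parDist B π₁ π₂) (parDist B π₁' π₂')
      ≤ ∑' r, parMatching B ω₁ ω₂ r * c r.1 r.2 := kantorovich_le (parMatching_mem hω₁ hω₂)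
    _ = ∑' r₁, ω₁ r₁ * ∑' r₂, ω₂ r₂ *
          c (.par B r₁.1 r₂.1) (.par B r₁.2 r₂.2) := by
        rw [parMatching, tsum_bind_mul]
        simp only [tsum_map_mul]
    _ ≤ ∑' r₁, ω₁ r₁ * ∑' r₂, ω₂ r₂ * probOr (d r₁.1 r₁.2) (d r₂.1 r₂.2) := by
        gcongr
        exact hc _ _ _ _
    _ = probOr (∑' r, ω₁ r * d r.1 r.2) (∑' r, ω₂ r * d r.1 r.2) :=
        tsum_mul_tsum_mul_probOr ω₁ ω₂ (fun r => hd r.1 r.2) (fun r => hd r.1 r.2)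
    _ ≤ probOr (u + ε / 2) (v + ε / 2) := probOr_mono hlt₁.le hlt₂.le
    _ ≤ probOr u v + (ε / 2 + ε / 2) := probOr_add_le _ _ _
    _ = probOr u v + ε := by rw [ENNReal.add_halves]

end Kantorovich

/-! ### Upper bounds on the bisimilarity metric -/

section Bisimilarity

variable {A : Type u}

/-- The bisimilarity metric lies below every symmetric distance that satisfies the transfer
condition, even if the latter is not a pseudometric: the pointwise infimum of all these distances
is a bisimulation metric, since they are closed under infima and under the operation that
enforces the triangle inequality. -/
theorem bisimilarityMetric_le_of_transfer {c : Proc A → Proc A → ℝ≥0∞}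
    (hsymm : ∀ s t, c s t = c t s) (hc : Transfer c) (s t : Proc A) :
    bisimilarityMetric A s t ≤ c s t := by
  classical
  let L : Set (Proc A → Proc A → ℝ≥0∞) := {d | (∀ s t, d s t = d t s) ∧ Transfer d}
  let l : Proc A → Proc A → ℝ≥0∞ := fun s t => ⨅ d : L, d.1 s t
  have hle : ∀ d ∈ L, ∀ s t, l s t ≤ d s t := fun d hd s t =>
    iInf_le (fun d : L => d.1 s t) ⟨d, hd⟩
  have hls : ∀ s t, l s t = l t s := fun s t => iInf_congr fun d => d.2.1 s t
  have htr : Transfer l := by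
    refine transfer_of_iInf l l (fun s t (d : L) => d.1 s t) (fun _ _ => rfl) ?_
    intro s t d hd a π hπ
    obtain ⟨π', hπ', hk⟩ := d.2.2 s t hd a π hπ
    exact ⟨π', hπ', (kantorovich_mono (hle d.1 d.2) π π').trans hk⟩
  have hdisc : ∀ s t, l s t ≤ if s = t then 0 else 1 := by
    refine hle _ ⟨fun s t => by simp only [eq_comm], fun s t hst a π hπ => ?_⟩
    by_cases h : s = t
    · subst h
      exact ⟨π, hπ, by rw [kantorovich_self (fun s => if_pos rfl)]; exact zero_le⟩
    · simp [h] at hst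
  have htri : ∀ s t r, l s r ≤ l s t + l t r := by
    let e : Proc A → Proc A → ℝ≥0∞ := fun s r => ⨅ t, (l s t + l t r)
    have hes : ∀ s r, e s r = e r s := fun s r => iInf_congr fun t => by
      rw [hls s t, hls t r, add_comm]
    have he : Transfer e := by
      refine transfer_of_iInf e e (fun s r t => l s t + l t r) (fun _ _ => rfl) ?_
      intro s r t hlt a π hπ
      obtain ⟨π', hπ', hk⟩ := htr s t (lt_of_le_of_lt le_self_add hlt) a π hπ
      obtain ⟨π'', hπ'', hk'⟩ := htr t r (lt_of_le_of_lt le_add_self hlt) a π' hπ'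
      exact ⟨π'', hπ'', (kantorovich_triangle (fun s t r => iInf_le _ t) π π' π'').trans
        (add_le_add hk hk')⟩
    exact fun s t r => (hle e ⟨hes, he⟩ s r).trans (iInf_le _ t)
  have hl : IsBisimulationMetric l :=
    { le_one := fun s t => (hdisc s t).trans (by split_ifs <;> simp)
      self := fun s => le_antisymm ((hdisc s s).trans (by simp)) zero_le
      symm := hls
      triangle := htri
      transfer := htr }
  exact ((bisimilarityMetric_isLeast A).2 hl s t).trans (hle c ⟨hsymm, hc⟩ s t)

theorem isBisimulationMetric_bisimilarityMetric (A : Type u) :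
    IsBisimulationMetric (bisimilarityMetric A) := (bisimilarityMetric_isLeast A).1

/-- The local form of `bisimilarityMetric_le_of_transfer`: the derivatives of `s` and `t` may be
compared by the bisimilarity metric itself. -/
theorem bisimilarityMetric_le_of_mimic {s t : Proc A} {v : ℝ≥0∞}
    (h₁ : v < 1 → ∀ a π, Step s a π →
      ∃ π', Step t a π' ∧ kantorovich (bisimilarityMetric A) π π' ≤ v)
    (h₂ : v < 1 → ∀ a π, Step t a π →
      ∃ π', Step s a π' ∧ kantorovich (bisimilarityMetric A) π π' ≤ v) :
    bisimilarityMetric A s t ≤ v := by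
  classical
  have hb := isBisimulationMetric_bisimilarityMetric A
  -- lower the bisimilarity metric to `v` at the one pair `s`, `t`
  let c : Proc A → Proc A → ℝ≥0∞ := fun x y =>
    if (x = s ∧ y = t) ∨ (x = t ∧ y = s) then min (bisimilarityMetric A x y) v
    else bisimilarityMetric A x y
  have hcb : ∀ x y, c x y ≤ bisimilarityMetric A x y := by
    intro x y
    simp only [c]
    split_ifs
    exacts [min_le_left _ _, le_rfl]
  have hsymm : ∀ x y, c x y = c y x := by
    intro x y
    simp only [c, hb.symm x y]
    congr 1
    apply propext
    tauto
  have hc : Transfer c := by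
    intro x y hxy a π hπ
    have old : bisimilarityMetric A x y < 1 →
        ∃ π', Step y a π' ∧ kantorovich c π π' ≤ bisimilarityMetric A x y := by
      intro h
      obtain ⟨π', hπ', hk⟩ := hb.transfer x y h a π hπ
      exact ⟨π', hπ', (kantorovich_mono hcb π π').trans hk⟩
    have new : (x = s ∧ y = t) ∨ (x = t ∧ y = s) → v < 1 →
        ∃ π', Step y a π' ∧ kantorovich c π π' ≤ v := by
      rintro (⟨rfl, rfl⟩ | ⟨rfl, rfl⟩) hv
      · obtain ⟨π', hπ', hk⟩ := h₁ hv a π hπ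
        exact ⟨π', hπ', (kantorovich_mono hcb π π').trans hk⟩
      · obtain ⟨π', hπ', hk⟩ := h₂ hv a π hπ
        exact ⟨π', hπ', (kantorovich_mono hcb π π').trans hk⟩
    by_cases hp : (x = s ∧ y = t) ∨ (x = t ∧ y = s)
    · simp only [c, if_pos hp] at hxy
      simp only [show c x y = min (bisimilarityMetric A x y) v from if_pos hp]
      rcases le_total (bisimilarityMetric A x y) v with h | h
      · rw [min_eq_left h] at hxy ⊢
        exact old hxy
      · rw [min_eq_right h] at hxy ⊢
        exact new hp hxy
    · simp only [show c x y = bisimilarityMetric A x y from if_neg hp] at hxy ⊢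
      exact old hxy
  refine (bisimilarityMetric_le_of_transfer hsymm hc s t).trans ?_
  exact (if_pos (Or.inl ⟨rfl, rfl⟩)).trans_le (min_le_right _ _)

theorem bisimilarityMetric_pre_le (a : A) (n : ℕ) (q : PMF (Fin n)) (hq : ∀ i, q i ≠ 0)
    (s t : Fin n → Proc A) :
    bisimilarityMetric A (.pre a n q hq s) (.pre a n q hq t) ≤
      ∑' i, q i * bisimilarityMetric A (s i) (t i) := by
  have hb := isBisimulationMetric_bisimilarityMetric A
  refine bisimilarityMetric_le_of_mimic ?_ ?_
  · rintro - _ _ ⟨⟩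
    exact ⟨_, .pre a n q hq t, kantorovich_map_le _ q s t⟩
  · rintro - _ _ ⟨⟩
    refine ⟨_, .pre a n q hq s, (kantorovich_map_le _ q t s).trans_eq ?_⟩
    simp only [hb.symm (t _)]

theorem bisimilarityMetric_alt_le (s₁ s₂ t₁ t₂ : Proc A) :
    bisimilarityMetric A (.alt s₁ s₂) (.alt t₁ t₂) ≤
      max (bisimilarityMetric A s₁ t₁) (bisimilarityMetric A s₂ t₂) := by
  have hb := isBisimulationMetric_bisimilarityMetric A
  have key : ∀ s₁ s₂ t₁ t₂ : Proc A,
      max (bisimilarityMetric A s₁ t₁) (bisimilarityMetric A s₂ t₂) < 1 →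
      ∀ a π, Step (.alt s₁ s₂) a π → ∃ π', Step (.alt t₁ t₂) a π' ∧
        kantorovich (bisimilarityMetric A) π π' ≤
          max (bisimilarityMetric A s₁ t₁) (bisimilarityMetric A s₂ t₂) := by
    intro s₁ s₂ t₁ t₂ hv a π hπ
    rw [max_lt_iff] at hv
    cases hπ with
    | alt_left h =>
      obtain ⟨π', hπ', hk⟩ := hb.transfer _ _ hv.1 a π h
      exact ⟨π', .alt_left hπ', hk.trans (le_max_left _ _)⟩
    | alt_right h =>
      obtain ⟨π', hπ', hk⟩ := hb.transfer _ _ hv.2 a π h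
      exact ⟨π', .alt_right hπ', hk.trans (le_max_right _ _)⟩
  refine bisimilarityMetric_le_of_mimic (key s₁ s₂ t₁ t₂) ?_
  rw [hb.symm s₁, hb.symm s₂]
  exact key t₁ t₂ s₁ s₂

open Classical in
/-- The distance that compares parallel compositions over the same synchronisation set
componentwise by `d`, and any other two processes by `1`. -/
noncomputable def parDistance (d : Proc A → Proc A → ℝ≥0∞) : Proc A → Proc A → ℝ≥0∞
  | .par B s₁ s₂, .par B' t₁ t₂ => if B = B' then probOr (d s₁ t₁) (d s₂ t₂) else 1
  | _, _ => 1

theorem parDistance_par (d : Proc A → Proc A → ℝ≥0∞) (B : Set A) (s₁ s₂ t₁ t₂ : Proc A) :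
    parDistance d (.par B s₁ s₂) (.par B t₁ t₂) = probOr (d s₁ t₁) (d s₂ t₂) := if_pos rfl

theorem exists_eq_par_of_parDistance_lt_one {d : Proc A → Proc A → ℝ≥0∞} {s t : Proc A}
    (h : parDistance d s t < 1) :
    ∃ B s₁ s₂ t₁ t₂, s = .par B s₁ s₂ ∧ t = .par B t₁ t₂ := by
  unfold parDistance at h
  split at h
  · split_ifs at h with hB
    · subst hB
      exact ⟨_, _, _, _, _, rfl, rfl⟩
    · exact absurd h (lt_irrefl _)
  · exact absurd h (lt_irrefl _)

theorem parDistance_symm {d : Proc A → Proc A → ℝ≥0∞} (hd : ∀ s t, d s t = d t s)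
    (s t : Proc A) : parDistance d s t = parDistance d t s := by
  cases s <;> cases t <;> try rfl
  simp only [parDistance, eq_comm, hd]

theorem transfer_parDistance {d : Proc A → Proc A → ℝ≥0∞} (hd : IsBisimulationMetric d) :
    Transfer (parDistance d) := by
  intro s t hst a π hπ
  obtain ⟨B, s₁, s₂, t₁, t₂, rfl, rfl⟩ := exists_eq_par_of_parDistance_lt_one hst
  rw [parDistance_par] at hst ⊢
  have h₁ := (le_probOr_left _ _ (hd.le_one s₁ t₁)).trans_lt hst
  have h₂ := (le_probOr_right _ _ (hd.le_one s₂ t₂)).trans_lt hst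
  have hpar : ∀ s₁ s₂ t₁ t₂, parDistance d (.par B s₁ s₂) (.par B t₁ t₂) ≤
      probOr (d s₁ t₁) (d s₂ t₂) := fun _ _ _ _ => (parDistance_par d B _ _ _ _).le
  cases hπ with
  | par_sync ha p₁ p₂ =>
    obtain ⟨π₁', hπ₁', k₁⟩ := hd.transfer _ _ h₁ a _ p₁
    obtain ⟨π₂', hπ₂', k₂⟩ := hd.transfer _ _ h₂ a _ p₂
    exact ⟨_, .par_sync ha hπ₁' hπ₂', kantorovich_parDist_le hd.le_one hpar h₁ h₂ k₁ k₂⟩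
  | par_left ha p₁ =>
    obtain ⟨π₁', hπ₁', k₁⟩ := hd.transfer _ _ h₁ a _ p₁
    exact ⟨_, .par_left ha hπ₁',
      kantorovich_parDist_le hd.le_one hpar h₁ h₂ k₁ (kantorovich_pure_le d s₂ t₂)⟩
  | par_right ha p₂ =>
    obtain ⟨π₂', hπ₂', k₂⟩ := hd.transfer _ _ h₂ a _ p₂
    exact ⟨_, .par_right ha hπ₂',
      kantorovich_parDist_le hd.le_one hpar h₁ h₂ (kantorovich_pure_le d s₁ t₁) k₂⟩

theorem bisimilarityMetric_par_le (B : Set A) (s₁ s₂ t₁ t₂ : Proc A) :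
    bisimilarityMetric A (.par B s₁ s₂) (.par B t₁ t₂) ≤
      probOr (bisimilarityMetric A s₁ t₁) (bisimilarityMetric A s₂ t₂) := by
  have hb := isBisimulationMetric_bisimilarityMetric A
  rw [← parDistance_par]
  exact bisimilarityMetric_le_of_transfer (parDistance_symm hb.symm) (transfer_parDistance hb) _ _

end Bisimilarity

/-! ### Distance approximations of mixtures and convolutions -/

section Approximation

variable {V : Type v}

theorem enatPow_zero (a : ℝ≥0∞) : enatPow a 0 = 1 := pow_zero a

theorem enatPow_one (a : ℝ≥0∞) : enatPow a 1 = a := pow_one a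

theorem enatPow_top_of_lt_one {a : ℝ≥0∞} (ha : a < 1) : enatPow a ⊤ = 0 :=
  tendsto_nhds_unique
    (tendsto_atTop_iInf fun _ _ h => pow_le_pow_right_of_le_one' ha.le h)
    (ENNReal.tendsto_pow_atTop_nhds_zero_of_lt_one ha)

theorem one_enatPow (k : ℕ∞) : enatPow 1 k = 1 := by
  cases k with
  | top => exact (iInf_congr fun n => one_pow n).trans iInf_const
  | coe n => exact one_pow n

theorem enatPow_le_one {a : ℝ≥0∞} (ha : a ≤ 1) (k : ℕ∞) : enatPow a k ≤ 1 := by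
  cases k with
  | top => exact (iInf_le _ 0).trans (by simp)
  | coe n => exact pow_le_one₀ zero_le ha

theorem enatPow_add {a : ℝ≥0∞} (ha : a ≤ 1) (k l : ℕ∞) :
    enatPow a (k + l) = enatPow a k * enatPow a l := by
  rcases ha.eq_or_lt with rfl | ha
  · simp [one_enatPow]
  cases k with
  | top => simp [enatPow_top_of_lt_one ha]
  | coe n =>
    cases l with
    | top => simp [enatPow_top_of_lt_one ha]
    | coe n' => exact pow_add a n n'

theorem tprod_enatPow_le_one (m : Mult V) (e : V → ℝ≥0∞) :
    ∏' x, enatPow (1 - e x) (m x) ≤ 1 :=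
  le_of_tendsto (multipliable_dda m e).hasProd
    (.of_forall fun _ => Finset.prod_le_one' fun _ _ => enatPow_le_one tsub_le_self _)

theorem tprod_enatPow_add (m₁ m₂ : Mult V) (e : V → ℝ≥0∞) :
    ∏' x, enatPow (1 - e x) ((m₁ + m₂) x) =
      (∏' x, enatPow (1 - e x) (m₁ x)) * ∏' x, enatPow (1 - e x) (m₂ x) := by
  -- multiplication on `ℝ≥0∞` is not continuous, but it is at finite factors
  have hne : ∀ m : Mult V, ∏' x, enatPow (1 - e x) (m x) ≠ ⊤ := fun m =>
    ne_top_of_le_ne_top ENNReal.one_ne_top (tprod_enatPow_le_one m e)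
  have h : HasProd (fun x => enatPow (1 - e x) ((m₁ + m₂) x))
      ((∏' x, enatPow (1 - e x) (m₁ x)) * ∏' x, enatPow (1 - e x) (m₂ x)) := by
    have := ENNReal.Tendsto.mul (multipliable_dda m₁ e).hasProd (.inr (hne m₂))
      (multipliable_dda m₂ e).hasProd (.inr (hne m₁))
    refine this.congr fun s => ?_
    rw [← Finset.prod_mul_distrib]
    exact Finset.prod_congr rfl fun x _ => (enatPow_add tsub_le_self _ _).symm
  exact h.tprod_eq

theorem dda_le_one (m : Mult V) (e : V → ℝ≥0∞) : dda m e ≤ 1 := tsub_le_self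

theorem dda_add (m₁ m₂ : Mult V) (e : V → ℝ≥0∞) :
    dda (m₁ + m₂) e = probOr (dda m₁ e) (dda m₂ e) := by
  unfold probOr dda
  rw [ENNReal.sub_sub_cancel ENNReal.one_ne_top (tprod_enatPow_le_one m₁ e),
    ENNReal.sub_sub_cancel ENNReal.one_ne_top (tprod_enatPow_le_one m₂ e), tprod_enatPow_add]

theorem dda_one (x : V) (e : V → ℝ≥0∞) (he : e x ≤ 1) : dda (Mult.one x) e = e x := by
  unfold dda
  rw [tprod_eq_mulSingle x]
  · simp [Mult.one, enatPow_one, ENNReal.sub_sub_cancel ENNReal.one_ne_top he]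
  · intro y hy
    simp [Mult.one, hy, enatPow_zero]

theorem pda_le_one (p : ProbMult V) (e : V → ℝ≥0∞) : pda p e ≤ 1 :=
  tsum_mul_le_one p fun m => dda_le_one m e

theorem pda_pure (m : Mult V) (e : V → ℝ≥0∞) : pda (PMF.pure m) e = dda m e :=
  tsum_pure_mul _ _

theorem pda_bind {ι : Type*} (q : PMF ι) (p : ι → ProbMult V) (e : V → ℝ≥0∞) :
    pda (q.bind p) e = ∑' i, q i * pda (p i) e :=
  tsum_bind_mul _ _ _

theorem pda_convolution (p₁ p₂ : ProbMult V) (e : V → ℝ≥0∞) :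
    pda (convolution p₁ p₂) e = probOr (pda p₁ e) (pda p₂ e) := by
  unfold pda convolution
  rw [tsum_bind_mul,
    ← tsum_mul_tsum_mul_probOr p₁ p₂ (fun m => dda_le_one m e) (fun m => dda_le_one m e)]
  simp only [tsum_map_mul, dda_add]

theorem pda_le_da {P : Set (ProbMult V)} {p : ProbMult V} (hp : p ∈ P) (e : V → ℝ≥0∞) :
    pda p e ≤ da P e :=
  le_iSup₂ (f := fun p (_ : p ∈ P) => pda p e) p hp

theorem da_mono {P Q : Set (ProbMult V)} (h : P ⊆ Q) (e : V → ℝ≥0∞) : da P e ≤ da Q e :=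
  iSup₂_le fun _ hp => pda_le_da (h hp) e

theorem exists_da_le_pda_add {P : Set (ProbMult V)} (hP : P.Nonempty) (e : V → ℝ≥0∞)
    {ε : ℝ≥0∞} (hε : ε ≠ 0) : ∃ p ∈ P, da P e ≤ pda p e + ε := by
  by_contra! h
  have hne : da P e ≠ ⊤ := ne_top_of_le_ne_top ENNReal.one_ne_top
    (iSup₂_le fun p _ => pda_le_one p e)
  obtain ⟨p₀, hp₀⟩ := hP
  have hpos : da P e ≠ 0 := (zero_le.trans_lt (h p₀ hp₀)).ne'
  have hle : da P e ≤ da P e - ε := iSup₂_le fun p hp => by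
    have := h p hp
    exact ENNReal.le_sub_of_add_le_right
      (ne_top_of_le_ne_top hne (le_add_self.trans this.le)) this.le
  exact absurd hle (not_le.2 (ENNReal.sub_lt_self hne hpos hε))

/-- The choices of near-optimal elements of the sets `P i` are independent of each other, so a
supremum over all families dominates the mixture of the suprema. -/
theorem tsum_mul_da_le {ι : Type*} {q : PMF ι} {P : ι → Set (ProbMult V)} {Q : Set (ProbMult V)}
    (hP : ∀ i, (P i).Nonempty) (hQ : ∀ p : ι → ProbMult V, (∀ i, p i ∈ P i) → q.bind p ∈ Q)
    (e : V → ℝ≥0∞) : ∑' i, q i * da (P i) e ≤ da Q e := by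
  refine ENNReal.le_of_forall_pos_le_add fun ε hε _ => ?_
  choose p hp hle using fun i => exists_da_le_pda_add (hP i) e (ENNReal.coe_ne_zero.2 hε.ne')
  calc ∑' i, q i * da (P i) e
      ≤ ∑' i, q i * (pda (p i) e + ε) := by
        gcongr with i
        exact hle i
    _ = pda (q.bind p) e + ε := by
        simp only [mul_add]
        rw [ENNReal.tsum_add, ENNReal.tsum_mul_right, q.tsum_coe, one_mul, pda_bind]
    _ ≤ da Q e + ε := by
        gcongr
        exact pda_le_da (hQ p hp) e

theorem probOr_da_le {P₁ P₂ Q : Set (ProbMult V)} (h₁ : P₁.Nonempty) (h₂ : P₂.Nonempty)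
    (hQ : ∀ p₁ ∈ P₁, ∀ p₂ ∈ P₂, convolution p₁ p₂ ∈ Q) (e : V → ℝ≥0∞) :
    probOr (da P₁ e) (da P₂ e) ≤ da Q e := by
  refine ENNReal.le_of_forall_pos_le_add fun ε hε _ => ?_
  have hε' : (ε / 2 : ℝ≥0∞) ≠ 0 := by simpa using hε.ne'
  obtain ⟨p₁, hp₁, hle₁⟩ := exists_da_le_pda_add h₁ e hε'
  obtain ⟨p₂, hp₂, hle₂⟩ := exists_da_le_pda_add h₂ e hε'
  calc probOr (da P₁ e) (da P₂ e)
      ≤ probOr (pda p₁ e + ε / 2) (pda p₂ e + ε / 2) := probOr_mono hle₁ hle₂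
    _ ≤ probOr (pda p₁ e) (pda p₂ e) + (ε / 2 + ε / 2) := probOr_add_le _ _ _
    _ = pda (convolution p₁ p₂) e + ε := by rw [pda_convolution, ENNReal.add_halves]
    _ ≤ da Q e + ε := by
        gcongr
        exact pda_le_da (hQ p₁ hp₁ p₂ hp₂) e

theorem ProbMult.Below.refl (p : ProbMult V) : p.Below p := by
  classical
  refine ⟨p.map fun m => (m, m),
    mem_matching_of_map (by rw [PMF.map_comp]; exact PMF.map_id p)
      (by rw [PMF.map_comp]; exact PMF.map_id p), fun m x => ?_⟩
  have key : ∀ m₁, (p.map fun m => (m, m)) (m₁, m) = if m₁ = m then p m else 0 := by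
    intro m₁
    rw [PMF.map_apply]
    by_cases h : m₁ = m
    · subst h
      rw [if_pos rfl, tsum_eq_single m₁]
      · simp
      · intro r hr
        simp [hr.symm]
    · rw [if_neg h, ENNReal.tsum_eq_zero]
      intro r
      rw [if_neg]
      rintro ⟨⟩
      exact h rfl
  -- conditioned on its second component `m`, the diagonal coupling is concentrated at `m`
  simp only [weighting, key, tsum_ite_eq, ite_mul, zero_mul]
  split_ifs
  · exact zero_le
  · rw [← mul_assoc]
    exact mul_le_of_le_one_left' (ENNReal.inv_mul_le_one _)

end Approximation

/-! ### Induction on terms -/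

theorem Term.denotation_nonempty {A : Type u} {V : Type v} (t : Term A V) :
    t.denotation.Nonempty := by
  induction t with
  | var x => exact ⟨_, _, rfl, .refl _⟩
  | nil => exact Set.singleton_nonempty _
  | pre a n q hq t ih =>
    choose p hp using ih
    exact ⟨_, p, hp, .refl _⟩
  | alt t₁ t₂ ih₁ ih₂ => exact ih₁.inl
  | par B t₁ t₂ ih₁ ih₂ =>
    obtain ⟨p₁, h₁⟩ := ih₁
    obtain ⟨p₂, h₂⟩ := ih₂
    exact ⟨_, p₁, h₁, p₂, h₂, .refl _⟩

end ProbPA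

theorem mainTheorem1 {A : Type u} {V : Type v} (t : ProbPA.Term A V)
    (σ₁ σ₂ : V → ProbPA.Proc A) :
    ProbPA.bisimilarityMetric A (t.subst σ₁) (t.subst σ₂) ≤
      ProbPA.da t.denotation (fun x => ProbPA.bisimilarityMetric A (σ₁ x) (σ₂ x)) := by
  have hb := ProbPA.isBisimulationMetric_bisimilarityMetric A
  induction t with
  | var x =>
    refine (ProbPA.dda_one x (fun x => ProbPA.bisimilarityMetric A (σ₁ x) (σ₂ x))
      (hb.le_one _ _)).symm.trans_le ?_
    rw [← ProbPA.pda_pure]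
    refine ProbPA.pda_le_da ?_ _
    exact ⟨_, rfl, .refl _⟩
  | nil => exact (hb.self _).trans_le zero_le
  | pre a n q hq t ih =>
    refine (ProbPA.bisimilarityMetric_pre_le a n q hq _ _).trans
      ((ENNReal.tsum_le_tsum fun i => mul_le_mul_right (ih i) (q i)).trans ?_)
    refine ProbPA.tsum_mul_da_le (fun i => (t i).denotation_nonempty) (fun p hp => ?_) _
    exact ⟨p, hp, .refl _⟩
  | alt t₁ t₂ ih₁ ih₂ =>
    exact (ProbPA.bisimilarityMetric_alt_le _ _ _ _).trans (max_le
      (ih₁.trans (ProbPA.da_mono Set.subset_union_left _))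
      (ih₂.trans (ProbPA.da_mono Set.subset_union_right _)))
  | par B t₁ t₂ ih₁ ih₂ =>
    refine (ProbPA.bisimilarityMetric_par_le B _ _ _ _).trans
      ((ProbPA.probOr_mono ih₁ ih₂).trans ?_)
    refine ProbPA.probOr_da_le t₁.denotation_nonempty t₂.denotation_nonempty
      (fun p₁ h₁ p₂ h₂ => ?_) _
    exact ⟨p₁, h₁, p₂, h₂, .refl _⟩
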